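/- For integers $n,q\ge 1$ let $Q=\{0,1,\dots,q\}$; the rank of $\mathbf{x}\in Q^n$ is $\sum_{i=1}^n x_i$, and for $m\ge 0$ and an integer $\rho$, $Q(m,\rho)$ denotes the set of all vectors in $Q^m$ of rank $\rho$ (empty if $\rho<0$). A family $\mathcal{F}\subseteq Q^n$ is $r$-rank uniform if all its members have rank $r$, and it is $(q+1)$-sum intersecting if for any two distinct $\mathbf{x},\mathbf{y}\in\mathcal{F}$ there is a coordinate $i$ with $x_i+y_i\ge q+1$. Theorem. Let $n,q,r\ge 1$ be integers with $\frac{q+1}{2}\le r\le\frac{qn}{2}$, and let $\mathcal{F}\subseteq Q^n$ be an $r$-rank uniform $(q+1)$-sum intersecting family. Then $$|\mathcal{F}|\le \sum_{j=\frac{q+1}{2}}^{q}|Q(n-1,r-j)|\quad\text{if } q+1 \text{ is even},$$ $$|\mathcal{F}|\le 1+\sum_{j=\lceil\frac{q+1}{2}\rceil}^{q}\ \sum_{i=1}^{\lfloor\frac{2(r-1)}{q}\rfloor}\left|Q\left(n-i,\,r-j-\tfrac{(i-1)q}{2}\right)\right|\quad\text{if } q+1 \text{ is odd}.$$ Both bounds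 are best possible: for all such $n,q,r$ there is an $r$-rank uniform $(q+1)$-sum intersecting family $\mathcal{F}\subseteq Q^n$ for which equality holds. -/

import Mathlib

/-- The set `Q^n` of vectors of length `n` with entries in `Q = {0, 1, …, q}`. -/
abbrev QVec (q n : ℕ) : Type := Fin n → Fin (q + 1)

namespace QVec

/-- The rank (weight) of a vector: the sum of its entries. -/
def rank {q n : ℕ} (x : QVec q n) : ℕ := ∑ i, (x i : ℕ)

/-- The size of the `s`-sum intersection of `x` and `y`: the number of coordinates `i` with
`x i + y i ≥ s` (the entries are added as natural numbers). -/
def sumInter {q n : ℕ} (s : ℕ) (x y : QVec q n) : ℕ :=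
  (Finset.univ.filter fun i : Fin n => s ≤ (x i : ℕ) + (y i : ℕ)).card

/-- A family is `s`-sum `t`-intersecting if any two (distinct) members have `s`-sum intersection
of size at least `t`. -/
def SumTIntersecting {q n : ℕ} (s t : ℕ) (F : Finset (QVec q n)) : Prop :=
  ∀ x ∈ F, ∀ y ∈ F, x ≠ y → t ≤ sumInter s x y

/-- `s`-sum intersecting means `s`-sum `1`-intersecting. -/
def SumIntersecting {q n : ℕ} (s : ℕ) (F : Finset (QVec q n)) : Prop :=
  SumTIntersecting s 1 F

/-- All members of the family have rank `r`. -/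
def RankUniform {q n : ℕ} (r : ℕ) (F : Finset (QVec q n)) : Prop :=
  ∀ x ∈ F, rank x = r

/-- `Q(n, r)`: the set of all vectors in `Q^n` of rank `r`. The rank is an integer here,
so that the set is empty for negative `r`. -/
def layer (q n : ℕ) (r : ℤ) : Finset (QVec q n) :=
  Finset.univ.filter fun x => (rank x : ℤ) = r

end QVec

open Finset

/-! The extremal family consists of the leading vectors: those whose first entry different from `q /
2` exceeds `q / 2`. Two of them always meet, at the earlier of their two decisive coordinates. The
vector `q - x` never meets `x`, and one of the two is leading unless `x` is constantly `q / 2`.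

For the upper bound, suppose first that every member also meets itself. Compression pushes mass
towards smaller coordinates; it keeps size, rank and pairwise meeting (`MeetsPairwise.compress`,
which rests on bounds for sets of integers whose sums avoid an interval), and it lowers a potential,
so the family may be taken stable. Then induct on `n`, slicing by the last entry `v`. Stability and
`2 * r ≤ q * n` make each slice pairwise meeting, so induction handles those with `v > q - d`, where
`d = q * n - 2 * r`. The slices `v` and `q - d - v` are exchanged in rank by reflection, and at most
one vector of each reflected pair can occur; the leading family attains this.

For odd `q`, compression also works without self-meeting, and a stable family of rank `r > q / 2`
meets itself automatically. For even `q`, at most one member fails to meet itself, which costs the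
extra `1`; a vector filled up with entries `q / 2` from the left shows that it is attained. The
stated sums count leading vectors by the position and value of the decisive entry. -/

/-! ### Sets of natural numbers whose sums avoid an interval -/

theorem card_add_card_le_of_add_ne {A B : Finset ℕ} {lo hi c : ℕ}
    (hA : ∀ a ∈ A, lo ≤ a ∧ a ≤ hi) (hB : ∀ b ∈ B, b ≤ c ∧ lo + b ≤ c ∧ c ≤ hi + b)
    (h : ∀ a ∈ A, ∀ b ∈ B, a + b ≠ c) : A.card + B.card ≤ hi + 1 - lo := by
  have hinj : Set.InjOn (fun b => c - b) (B : Set ℕ) := by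
    intro b hb b' hb' hbb
    have h1 := hB b hb
    have h2 := hB b' hb'
    simp only at hbb
    omega
  -- `A` and the reflection `c - B` are disjoint subsets of `[lo, hi]`.
  rw [← card_image_of_injOn hinj, ← card_union_of_disjoint, ← Nat.card_Icc]
  · refine card_le_card fun x hx => ?_
    rw [mem_union, mem_image] at hx
    rw [mem_Icc]
    rcases hx with hx | ⟨b, hb, rfl⟩
    · exact hA x hx
    · have := hB b hb
      omega
  · rw [disjoint_left]
    intro x hx hx'
    obtain ⟨b, hb, rfl⟩ := mem_image.1 hx'
    have := hB b hb
    exact h _ hx b hb (by omega)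

/-- If all sums `a + b` avoid the interval `[d, q]`, then `A` misses the reflection of `B`
together with a whole interval of length `q - d` below it. -/
theorem card_add_card_le_of_add_not_mem_Icc {A B : Finset ℕ} {lo hi d q : ℕ}
    (hA : ∀ a ∈ A, lo ≤ a ∧ a ≤ hi) (hB : ∀ b ∈ B, lo + b ≤ d ∧ q ≤ hi + b) (hd : d ≤ q)
    (hne : B.Nonempty) (h : ∀ a ∈ A, ∀ b ∈ B, q < a + b ∨ a + b < d) :
    A.card + B.card + (q - d) ≤ hi + 1 - lo := by
  have hinj : Set.InjOn (fun b => q - b) (B : Set ℕ) := by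
    intro b hb b' hb' hbb
    have h1 := hB b hb
    have h2 := hB b' hb'
    simp only at hbb
    omega
  -- For the largest `m` in `B`, the interval `[d - m, q - m)` lies just below `q - B`, and it
  -- misses `A` because no sum `a + m` falls in `[d, q)`.
  obtain ⟨m, hm, hmax⟩ := B.exists_max_image id hne
  have hmB := hB m hm
  have hcard : (Ico (d - m) (q - m)).card = q - d := by
    rw [Nat.card_Ico]
    omega
  rw [← card_image_of_injOn hinj, ← hcard, ← card_union_of_disjoint, ← card_union_of_disjoint,
    ← Nat.card_Icc]
  · refine card_le_card fun x hx => ?_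
    rw [mem_union, mem_union, mem_image, mem_Ico] at hx
    rw [mem_Icc]
    rcases hx with (hx | ⟨b, hb, rfl⟩) | hx
    · exact hA x hx
    · have := hB b hb
      omega
    · omega
  · rw [disjoint_left]
    intro x hx hx'
    rw [mem_Ico] at hx'
    rw [mem_union, mem_image] at hx
    rcases hx with hx | ⟨b, hb, rfl⟩
    · have := h x hx m hm
      omega
    · have := hmax b hb
      simp only [id] at this
      omega
  · rw [disjoint_left]
    intro x hx hx'
    obtain ⟨b, hb, rfl⟩ := mem_image.1 hx'
    have h1 := hB b hb
    have h2 := h _ hx b hb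
    omega

/-- `A` and `B` will be the `i`-th coordinates of the members on two lines with coordinate sums `s`
and `t`. Members meet at `i` if `a + b > q` and at `j` if `(s - a) + (t - b) > q`, so the sums avoid
`[s + t - q, q]`. -/
theorem card_add_card_le_of_sum_avoids {A B : Finset ℕ} {q s t : ℕ} (hs : s ≤ q) (ht : t ≤ q)
    (hA : ∀ a ∈ A, a ≤ s) (hB : ∀ b ∈ B, b ≤ t) (hAne : A.Nonempty) (hBne : B.Nonempty)
    (h : ∀ a ∈ A, ∀ b ∈ B, q < a + b ∨ a + b + q < s + t) :
    A.card + B.card + q ≤ s + t + 1 := by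
  have hst : q ≤ s + t := by
    obtain ⟨a, ha⟩ := hAne
    obtain ⟨b, hb⟩ := hBne
    have := h a ha b hb
    have := hA a ha
    have := hB b hb
    omega
  -- An `a < q - t` has all its sums with `B` below `q`, hence below `s + t - q`; this confines `B`
  -- to `[0, s + t - q)`. Symmetrically for a small `b`.
  by_cases hlA : ∃ a ∈ A, a + t < q <;> by_cases hlB : ∃ b ∈ B, b + s < q
  · obtain ⟨a, ha, hat⟩ := hlA
    obtain ⟨b, hb, hbs⟩ := hlB
    have := card_add_card_le_of_add_ne (A := A) (B := B) (lo := 0) (hi := s + t - q)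
      (c := s + t - q)
      (fun a' ha' => by have := h a' ha' b hb; have := hA a' ha'; omega)
      (fun b' hb' => by have := h a ha b' hb'; have := hB b' hb'; omega)
      (fun a' ha' b' hb' => by have := h a' ha' b' hb'; omega)
    omega
  · push Not at hlB
    obtain ⟨a, ha, hat⟩ := hlA
    have := card_add_card_le_of_add_not_mem_Icc (A := A) (B := B) (lo := 0) (hi := s)
      (d := s + t - q) (q := q)
      (fun a' ha' => by have := hA a' ha'; omega)
      (fun b' hb' => by
        have := h a ha b' hb'; have := hB b' hb'; have := hlB b' hb'; omega)
      (by omega) hBne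
      (fun a' ha' b' hb' => by have := h a' ha' b' hb'; omega)
    omega
  · push Not at hlA
    obtain ⟨b, hb, hbs⟩ := hlB
    have := card_add_card_le_of_add_not_mem_Icc (A := B) (B := A) (lo := 0) (hi := t)
      (d := s + t - q) (q := q)
      (fun b' hb' => by have := hB b' hb'; omega)
      (fun a' ha' => by
        have := h a' ha' b hb; have := hA a' ha'; have := hlA a' ha'; omega)
      (by omega) hAne
      (fun b' hb' a' ha' => by have := h a' ha' b' hb'; omega)
    omega
  · push Not at hlA hlB
    have := card_add_card_le_of_add_ne (A := A) (B := B) (lo := q - t) (hi := s) (c := q)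
      (fun a' ha' => by have := hlA a' ha'; have := hA a' ha'; omega)
      (fun b' hb' => by have := hlB b' hb'; have := hB b' hb'; omega)
      (fun a' ha' b' hb' => by have := h a' ha' b' hb'; omega)
    omega

theorem card_add_card_le_of_sum_avoids_of_lt {A B : Finset ℕ} {q s t : ℕ} (hs : q < s)
    (hst : s + t ≤ 2 * q) (hA : ∀ a ∈ A, s ≤ a + q ∧ a ≤ q) (hB : ∀ b ∈ B, b ≤ t)
    (hBne : B.Nonempty) (h : ∀ a ∈ A, ∀ b ∈ B, q < a + b ∨ a + b + q < s + t) :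
    A.card + B.card ≤ t + 1 := by
  have := card_add_card_le_of_add_not_mem_Icc (A := A) (B := B) (lo := s - q) (hi := q)
    (d := s + t - q) (q := q)
    (fun a ha => by have := hA a ha; omega)
    (fun b hb => by have := hB b hb; omega)
    (by omega) hBne
    (fun a ha b hb => by have := h a ha b hb; omega)
  omega

/-- The case of a single line, where only distinct members are known to meet. The reflections used
are about `q` and `2 * s - q`, which are odd, so `a + a` avoids them for free. -/
theorem two_mul_card_le_of_sum_avoids {A : Finset ℕ} {q s : ℕ} (hq : Odd q) (hs : s ≤ q)
    (hA : ∀ a ∈ A, a ≤ s) (hcard : 2 ≤ A.card)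
    (h : ∀ a ∈ A, ∀ b ∈ A, a ≠ b → q < a + b ∨ a + b + q < 2 * s) :
    A.card + A.card + q ≤ 2 * s + 1 := by
  obtain ⟨p, hp⟩ := hq
  by_cases hl : ∃ a ∈ A, a + s < q
  · obtain ⟨a, ha, has⟩ := hl
    obtain ⟨b, hb, hba⟩ := exists_mem_ne hcard a
    have hab := h b hb a ha hba
    have hbs := hA b hb
    have key : ∀ x ∈ A, x + q < 2 * s := by
      intro x hx
      rcases eq_or_ne x a with rfl | hxa
      · omega
      · have := h x hx a ha hxa
        have := hA x hx
        omega
    have := card_add_card_le_of_add_ne (A := A) (B := A) (lo := 0) (hi := 2 * s - q)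
      (c := 2 * s - q)
      (fun x hx => by have := key x hx; omega)
      (fun x hx => by have := key x hx; omega)
      (fun x hx y hy hxy => by
        have := key x hx
        have := h x hx y hy (by omega)
        omega)
    omega
  · push Not at hl
    have hs' : q ≤ 2 * s := by
      obtain ⟨a, ha⟩ := card_pos.1 (by omega : 0 < A.card)
      have := hl a ha
      have := hA a ha
      omega
    have := card_add_card_le_of_add_ne (A := A) (B := A) (lo := q - s) (hi := s) (c := q)
      (fun x hx => by have := hl x hx; have := hA x hx; omega)
      (fun x hx => by have := hl x hx; have := hA x hx; omega)
      (fun x hx y hy hxy => by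
        have := h x hx y hy (by omega)
        omega)
    omega

/-! ### Compression along the directions `e i - e j` -/

namespace QVec

variable {q n : ℕ}

/-- Two vectors meet if some coordinates sum up to at least `q + 1`. -/
def Meets (x y : QVec q n) : Prop := ∃ i, q < (x i : ℕ) + y i

theorem Meets.symm {x y : QVec q n} (h : Meets x y) : Meets y x := by
  obtain ⟨i, hi⟩ := h
  exact ⟨i, by omega⟩

theorem not_meets {x y : QVec q n} : ¬ Meets x y ↔ ∀ i, (x i : ℕ) + y i ≤ q := by
  simp [Meets]

theorem one_le_sumInter {x y : QVec q n} : 1 ≤ sumInter (q + 1) x y ↔ Meets x y := by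
  rw [sumInter, Nat.one_le_iff_ne_zero, ← Nat.pos_iff_ne_zero, card_pos]
  simp [Finset.Nonempty, Meets]

/-- Any two members meet; a member has to meet itself only if `W` holds. -/
def MeetsPairwise (W : Prop) (F : Finset (QVec q n)) : Prop :=
  ∀ x ∈ F, ∀ y ∈ F, (x = y → W) → Meets x y

/-- The data determining the line through `x` in direction `e i - e j`. -/
def lineKey (i j : Fin n) (x : QVec q n) : QVec q n × ℕ :=
  (fun k => if k = i ∨ k = j then 0 else x k, (x i : ℕ) + x j)

theorem lineKey_eq_iff {i j : Fin n} {x y : QVec q n} :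
    lineKey i j x = lineKey i j y ↔
      (∀ k, k ≠ i → k ≠ j → x k = y k) ∧ (x i : ℕ) + x j = y i + y j := by
  rw [lineKey, lineKey, Prod.mk.injEq, funext_iff]
  refine and_congr (forall_congr' fun k => ?_) Iff.rfl
  by_cases h1 : k = i
  · simp [h1]
  · by_cases h2 : k = j
    · simp [h2]
    · simp [h1, h2]

theorem eq_of_lineKey_eq {i j : Fin n} {x y : QVec q n} (h : lineKey i j x = lineKey i j y)
    (hi : (x i : ℕ) = y i) : x = y := by
  rw [lineKey_eq_iff] at h
  funext k
  by_cases h1 : k = i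
  · exact h1 ▸ Fin.ext hi
  · by_cases h2 : k = j
    · have := h.2
      exact h2 ▸ Fin.ext (by omega)
    · exact h.1 k h1 h2

theorem sum_add_eq_of_lineKey_eq {i j : Fin n} (hij : i ≠ j) {x y : QVec q n}
    (h : lineKey i j x = lineKey i j y) (c : Fin n → ℕ) :
    ∑ k, c k * x k + (c i * y i + c j * y j) = ∑ k, c k * y k + (c i * x i + c j * x j) := by
  rw [lineKey_eq_iff] at h
  have hj : j ∈ univ.erase i := mem_erase.2 ⟨hij.symm, mem_univ _⟩
  rw [← add_sum_erase univ (fun k => c k * (x k : ℕ)) (mem_univ i), ← add_sum_erase _ _ hj,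
    ← add_sum_erase univ (fun k => c k * (y k : ℕ)) (mem_univ i), ← add_sum_erase _ _ hj]
  have : ∑ k ∈ (univ.erase i).erase j, c k * (x k : ℕ)
      = ∑ k ∈ (univ.erase i).erase j, c k * (y k : ℕ) := by
    refine sum_congr rfl fun k hk => ?_
    rw [mem_erase, mem_erase] at hk
    rw [h.1 k hk.2.1 hk.1]
  omega

theorem rank_eq_of_lineKey_eq {i j : Fin n} (hij : i ≠ j) {x y : QVec q n}
    (h : lineKey i j x = lineKey i j y) : rank x = rank y := by
  have h1 := sum_add_eq_of_lineKey_eq hij h (fun _ => 1)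
  have h2 := (lineKey_eq_iff.1 h).2
  simp only [one_mul] at h1
  unfold rank
  omega

/-- A potential that drops when mass is moved to smaller coordinates. -/
def moment (x : QVec q n) : ℕ := ∑ k : Fin n, (k : ℕ) * x k

theorem moment_lt_of_lineKey_eq {i j : Fin n} (hij : i < j) {x y : QVec q n}
    (h : lineKey i j x = lineKey i j y) (hxy : (y i : ℕ) < x i) : moment x < moment y := by
  have h1 := sum_add_eq_of_lineKey_eq hij.ne h (fun k => (k : ℕ))
  have h2 := (lineKey_eq_iff.1 h).2
  have h3 : (i : ℕ) < j := hij
  unfold moment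
  obtain ⟨d, hd⟩ := Nat.exists_eq_add_of_lt hxy
  obtain ⟨e, he⟩ := Nat.exists_eq_add_of_lt h3
  have h4 : (y j : ℕ) = x j + d + 1 := by omega
  rw [h4, he, hd] at h1
  nlinarith

/-- The members of `F` on the line through `x` in direction `e i - e j`. -/
def line (i j : Fin n) (F : Finset (QVec q n)) (x : QVec q n) : Finset (QVec q n) :=
  F.filter fun y => lineKey i j y = lineKey i j x

theorem mem_line {i j : Fin n} {F : Finset (QVec q n)} {x y : QVec q n} :
    y ∈ line i j F x ↔ y ∈ F ∧ lineKey i j y = lineKey i j x := by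
  simp [line]

/-- On each line in direction `e i - e j`, replace the members of `F` by the same number of
vectors with the largest `i`-th coordinates. -/
def compress (i j : Fin n) (F : Finset (QVec q n)) : Finset (QVec q n) :=
  -- The minimum is the largest `i`-th coordinate on the line through `x`.
  univ.filter fun x => min q ((x i : ℕ) + x j) < x i + (line i j F x).card

theorem line_congr {i j : Fin n} (F : Finset (QVec q n)) {x y : QVec q n}
    (h : lineKey i j x = lineKey i j y) : line i j F x = line i j F y := by
  simp [line, h]

theorem mem_compress {i j : Fin n} {F : Finset (QVec q n)} {x : QVec q n} :
    x ∈ compress i j F ↔ min q ((x i : ℕ) + x j) < x i + (line i j F x).card := by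
  simp [compress]

theorem injOn_line (i j : Fin n) (F : Finset (QVec q n)) (x : QVec q n) :
    Set.InjOn (fun y : QVec q n => (y i : ℕ)) (line i j F x) := by
  intro y hy z hz hyz
  rw [mem_coe, mem_line] at hy hz
  exact eq_of_lineKey_eq (hy.2.trans hz.2.symm) hyz

theorem bounds_of_mem_line {i j : Fin n} {F : Finset (QVec q n)} {x y : QVec q n}
    (hy : y ∈ line i j F x) :
    (x i : ℕ) + x j ≤ y i + q ∧ (y i : ℕ) ≤ q ∧ (y i : ℕ) ≤ x i + x j := by
  have h := (lineKey_eq_iff.1 (mem_line.1 hy).2).2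
  have h1 := (y i).is_lt
  have h2 := (y j).is_lt
  omega

theorem card_line_le (i j : Fin n) (F : Finset (QVec q n)) (x : QVec q n) :
    (line i j F x).card + ((x i : ℕ) + x j - q) ≤ min q ((x i : ℕ) + x j) + 1 := by
  have hle : (line i j F x).card ≤
      (Icc ((x i : ℕ) + x j - q) (min q ((x i : ℕ) + x j))).card := by
    refine card_le_card_of_injOn (fun y => (y i : ℕ)) (fun y hy => ?_) (injOn_line i j F x)
    have := bounds_of_mem_line hy
    simp only [coe_Icc, Set.mem_Icc]
    omega
  rw [Nat.card_Icc] at hle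
  have h1 := (x i).is_lt
  have h2 := (x j).is_lt
  omega

theorem exists_on_line {i j : Fin n} (hij : i ≠ j) (x : QVec q n) {a : ℕ}
    (h1 : (x i : ℕ) + x j ≤ a + q) (h2 : a ≤ q) (h3 : a ≤ (x i : ℕ) + x j) :
    ∃ y : QVec q n, lineKey i j y = lineKey i j x ∧ (y i : ℕ) = a := by
  refine ⟨Function.update (Function.update x j ⟨(x i : ℕ) + x j - a, by omega⟩) i
    ⟨a, by omega⟩, ?_, by simp⟩
  rw [lineKey_eq_iff]
  refine ⟨fun k hi hj => by simp [hi, hj], ?_⟩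
  simp only [Function.update_self, Function.update_of_ne hij.symm]
  omega

theorem card_line_compress {i j : Fin n} (hij : i ≠ j) (F : Finset (QVec q n)) (x : QVec q n) :
    (line i j (compress i j F) x).card = (line i j F x).card := by
  have hk := card_line_le i j F x
  have : (line i j (compress i j F) x).image (fun y => (y i : ℕ)) =
      Icc (min q ((x i : ℕ) + x j) + 1 - (line i j F x).card) (min q ((x i : ℕ) + x j)) := by
    ext a
    rw [mem_image, mem_Icc]
    constructor
    · rintro ⟨y, hy, rfl⟩
      have hb := bounds_of_mem_line hy
      rw [mem_line, mem_compress] at hy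
      rw [line_congr F hy.2, (lineKey_eq_iff.1 hy.2).2] at hy
      omega
    · rintro ⟨h1, h2⟩
      obtain ⟨y, hy, rfl⟩ := exists_on_line hij x (a := a) (by omega) (by omega) (by omega)
      refine ⟨y, ?_, rfl⟩
      rw [mem_line, mem_compress, line_congr F hy, (lineKey_eq_iff.1 hy).2]
      exact ⟨by omega, hy⟩
  rw [← card_image_of_injOn (injOn_line i j _ x), this, Nat.card_Icc]
  omega

theorem card_compress {i j : Fin n} (hij : i ≠ j) (F : Finset (QVec q n)) :
    (compress i j F).card = F.card := by
  have hmap : ∀ G : Finset (QVec q n), ∀ x ∈ G, lineKey i j x ∈ univ.image (lineKey i j) :=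
    fun _ x _ => mem_image_of_mem _ (mem_univ x)
  rw [card_eq_sum_card_fiberwise (hmap (compress i j F)), card_eq_sum_card_fiberwise (hmap F)]
  refine sum_congr rfl fun κ hκ => ?_
  obtain ⟨x, -, rfl⟩ := mem_image.1 hκ
  exact card_line_compress hij F x

theorem sum_lt_sum_of_card_eq {α : Type*} [DecidableEq α] {A T : Finset α} {ψ : α → ℕ}
    (hcard : T.card = A.card) (hne : T ≠ A)
    (h : ∀ t ∈ T, t ∉ A → ∀ a ∈ A, a ∉ T → ψ t < ψ a) : ∑ t ∈ T, ψ t < ∑ a ∈ A, ψ a := by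
  have hc : (T \ A).card = (A \ T).card := card_sdiff_comm hcard
  have hpos : (T \ A).Nonempty := by
    rw [sdiff_nonempty]
    exact fun hsub => hne (eq_of_subset_of_card_le hsub hcard.ge)
  obtain ⟨m, hm, hmax⟩ := (T \ A).exists_max_image ψ hpos
  rw [mem_sdiff] at hm
  have h1 : ∑ t ∈ T \ A, ψ t ≤ (T \ A).card • ψ m := sum_le_card_nsmul _ _ _ hmax
  have h2 : (A \ T).card • (ψ m + 1) ≤ ∑ a ∈ A \ T, ψ a :=
    card_nsmul_le_sum _ _ _ fun a ha => h m hm.1 hm.2 a (mem_sdiff.1 ha).1 (mem_sdiff.1 ha).2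
  have hp := hpos.card_pos
  rw [← hc] at h2
  rw [← sum_inter_add_sum_sdiff T A, ← sum_inter_add_sum_sdiff A T, inter_comm A T]
  simp only [smul_eq_mul] at h1 h2
  nlinarith

theorem sum_moment_compress_lt {i j : Fin n} (hij : i < j) {F : Finset (QVec q n)}
    (hne : compress i j F ≠ F) : ∑ x ∈ compress i j F, moment x < ∑ x ∈ F, moment x := by
  have hmap : ∀ G : Finset (QVec q n), ∀ x ∈ G, lineKey i j x ∈ univ.image (lineKey i j) :=
    fun _ x _ => mem_image_of_mem _ (mem_univ x)
  have key : ∀ x : QVec q n, line i j (compress i j F) x ≠ line i j F x →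
      ∑ y ∈ line i j (compress i j F) x, moment y < ∑ y ∈ line i j F x, moment y := by
    intro x hx
    refine sum_lt_sum_of_card_eq (card_line_compress hij.ne F x) hx fun t ht htA a ha haT => ?_
    rw [mem_line] at ht htA ha haT
    refine moment_lt_of_lineKey_eq hij (ht.2.trans ha.2.symm) ?_
    have h1 := mem_compress.1 ht.1
    have h2 : a ∉ compress i j F := fun h => haT ⟨h, ha.2⟩
    rw [mem_compress] at h2
    rw [line_congr F (ht.2.trans ha.2.symm),
      (lineKey_eq_iff.1 (ht.2.trans ha.2.symm)).2] at h1
    omega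
  rw [← sum_fiberwise_of_maps_to (hmap (compress i j F)), ← sum_fiberwise_of_maps_to (hmap F)]
  apply sum_lt_sum
  · intro κ hκ
    obtain ⟨x, -, rfl⟩ := mem_image.1 hκ
    by_cases hx : line i j (compress i j F) x = line i j F x
    · exact (congrArg (fun s : Finset (QVec q n) => ∑ y ∈ s, moment y) hx).le
    · exact (key x hx).le
  · by_contra hcon
    push Not at hcon
    refine hne (ext fun x => ?_)
    have hx : line i j (compress i j F) x = line i j F x := by
      by_contra hx
      exact absurd (key x hx) (not_lt.2 (hcon _ (mem_image_of_mem _ (mem_univ x))))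
    have := Finset.ext_iff.1 hx x
    simpa [mem_line] using this

theorem exists_mem_line_of_mem_compress {i j : Fin n} {F : Finset (QVec q n)} {x : QVec q n}
    (hx : x ∈ compress i j F) : (line i j F x).Nonempty := by
  rw [mem_compress] at hx
  have := (x i).is_lt
  exact card_pos.1 (by omega)

theorem RankUniform.compress {i j : Fin n} (hij : i ≠ j) {r : ℕ} {F : Finset (QVec q n)}
    (hF : RankUniform r F) : RankUniform r (compress i j F) := by
  intro x hx
  obtain ⟨y, hy⟩ := exists_mem_line_of_mem_compress hx
  rw [mem_line] at hy
  rw [← rank_eq_of_lineKey_eq hij hy.2]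
  exact hF y hy.1

/-- If compressed vectors `x`, `y` do not meet, then `x i + y i ≤ q` forces their lines to contain
many members of `F`, more than the avoidance bounds permit. Parity is needed only when both lie on
one line and self-meeting is not assumed. -/
theorem MeetsPairwise.compress {W : Prop} (hW : W ∨ Odd q) {i j : Fin n}
    {F : Finset (QVec q n)} (hF : MeetsPairwise W F) : MeetsPairwise W (compress i j F) := by
  intro x hx y hy hxy
  by_contra hcon
  rw [not_meets] at hcon
  obtain ⟨u₀, hu₀⟩ := exists_mem_line_of_mem_compress hx
  obtain ⟨w₀, hw₀⟩ := exists_mem_line_of_mem_compress hy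
  have hci := hcon i
  have hcj := hcon j
  -- Off `i` and `j`, `u` and `w` agree with `x` and `y`, so they can meet only at `i` or at `j`.
  have hmeet : ∀ u ∈ line i j F x, ∀ w ∈ line i j F y, (u = w → W) →
      q < (u i : ℕ) + w i ∨ (u i : ℕ) + w i + q < ((x i : ℕ) + x j) + (y i + y j) := by
    intro u hu w hw huw
    rw [mem_line] at hu hw
    obtain ⟨k, hk⟩ := hF u hu.1 w hw.1 huw
    have hu' := lineKey_eq_iff.1 hu.2
    have hw' := lineKey_eq_iff.1 hw.2
    by_cases hki : k = i
    · subst hki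
      exact Or.inl hk
    · by_cases hkj : k = j
      · subst hkj
        right
        omega
      · have := hcon k
        rw [hu'.1 k hki hkj, hw'.1 k hki hkj] at hk
        omega
  rw [mem_compress] at hx hy
  have cardA := card_image_of_injOn (injOn_line i j F x)
  have cardB := card_image_of_injOn (injOn_line i j F y)
  set A := (line i j F x).image (fun u => (u i : ℕ)) with hA
  set B := (line i j F y).image (fun u => (u i : ℕ)) with hB
  have hAne : A.Nonempty := ⟨_, mem_image_of_mem _ hu₀⟩
  have hBne : B.Nonempty := ⟨_, mem_image_of_mem _ hw₀⟩
  have hAb : ∀ a ∈ A, (x i : ℕ) + x j ≤ a + q ∧ a ≤ q ∧ a ≤ x i + x j := by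
    intro a ha
    obtain ⟨u, hu, rfl⟩ := mem_image.1 ha
    exact bounds_of_mem_line hu
  have hBb : ∀ a ∈ B, (y i : ℕ) + y j ≤ a + q ∧ a ≤ q ∧ a ≤ y i + y j := by
    intro a ha
    obtain ⟨u, hu, rfl⟩ := mem_image.1 ha
    exact bounds_of_mem_line hu
  by_cases hall : lineKey i j x = lineKey i j y ∧ ¬ W
  · obtain ⟨hkey, hnW⟩ := hall
    have hodd := hW.resolve_left hnW
    have hs := (lineKey_eq_iff.1 hkey).2
    have hne : (x i : ℕ) ≠ y i := fun h => hnW (hxy (eq_of_lineKey_eq hkey h))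
    have hAB : B = A := by rw [hA, hB, line_congr F hkey]
    rw [hAB] at cardB
    have hcard : 2 ≤ A.card := by
      have := (x i).is_lt
      have := (y i).is_lt
      omega
    have := two_mul_card_le_of_sum_avoids (A := A) (q := q) (s := (x i : ℕ) + x j) hodd
      (by omega) (fun a ha => (hAb a ha).2.2) hcard (by
        intro a ha b hb hab
        obtain ⟨u, hu, rfl⟩ := mem_image.1 ha
        obtain ⟨w, hw, rfl⟩ := mem_image.1 hb
        rw [line_congr F hkey] at hw
        have := hmeet u hu w hw (fun h => absurd (by rw [h]) hab)
        omega)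
    omega
  · have havoid : ∀ a ∈ A, ∀ b ∈ B,
        q < a + b ∨ a + b + q < ((x i : ℕ) + x j) + (y i + y j) := by
      intro a ha b hb
      obtain ⟨u, hu, rfl⟩ := mem_image.1 ha
      obtain ⟨w, hw, rfl⟩ := mem_image.1 hb
      refine hmeet u hu w hw fun h => ?_
      subst h
      by_contra hnW
      exact hall ⟨(mem_line.1 hu).2.symm.trans (mem_line.1 hw).2, hnW⟩
    -- Since `x` and `y` do not meet, the two coordinate sums add up to at most `2 * q`; at most one
    -- of them exceeds `q`.
    by_cases hs : (x i : ℕ) + x j ≤ q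
    · by_cases ht : (y i : ℕ) + y j ≤ q
      · have := card_add_card_le_of_sum_avoids hs ht (fun a ha => (hAb a ha).2.2)
          (fun a ha => (hBb a ha).2.2) hAne hBne havoid
        omega
      · have := card_add_card_le_of_sum_avoids_of_lt (A := B) (B := A) (q := q)
          (s := (y i : ℕ) + y j) (t := (x i : ℕ) + x j) (by omega) (by omega)
          (fun a ha => ⟨(hBb a ha).1, (hBb a ha).2.1⟩) (fun a ha => (hAb a ha).2.2) hAne
          (fun b hb a ha => by have := havoid a ha b hb; omega)
        omega
    · have := card_add_card_le_of_sum_avoids_of_lt (A := A) (B := B) (q := q)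
          (s := (x i : ℕ) + x j) (t := (y i : ℕ) + y j) (by omega) (by omega)
          (fun a ha => ⟨(hAb a ha).1, (hAb a ha).2.1⟩) (fun a ha => (hBb a ha).2.2) hBne
          havoid
      omega

/-- `F` is closed under moving mass to smaller coordinates. -/
def Stable (F : Finset (QVec q n)) : Prop := ∀ i j : Fin n, i < j → compress i j F = F

theorem exists_stable {W : Prop} (hW : W ∨ Odd q) {r : ℕ} (F : Finset (QVec q n))
    (hr : RankUniform r F) (hF : MeetsPairwise W F) :
    ∃ G : Finset (QVec q n), Stable G ∧ RankUniform r G ∧ MeetsPairwise W G ∧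
      G.card = F.card := by
  induction hN : ∑ x ∈ F, moment x using Nat.strong_induction_on generalizing F with
  | _ N ih =>
    by_cases hs : Stable F
    · exact ⟨F, hs, hr, hF, rfl⟩
    · unfold Stable at hs
      push Not at hs
      obtain ⟨i, j, hij, hne⟩ := hs
      obtain ⟨G, h1, h2, h3, h4⟩ := ih _ (hN ▸ sum_moment_compress_lt hij hne)
        (QVec.compress i j F) (hr.compress hij.ne) (hF.compress hW) rfl
      exact ⟨G, h1, h2, h3, h4.trans (card_compress hij.ne F)⟩

theorem Stable.mem_of_lineKey_eq {F : Finset (QVec q n)} (hF : Stable F) {i j : Fin n}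
    (hij : i < j) {x y : QVec q n} (hx : x ∈ F) (h : lineKey i j y = lineKey i j x)
    (hxy : (x i : ℕ) ≤ y i) : y ∈ F := by
  rw [← hF i j hij, mem_compress] at hx ⊢
  rw [line_congr F h, (lineKey_eq_iff.1 h).2]
  omega

end QVec

/-! ### Leading vectors and the induction on the length -/

namespace QVec

variable {q n : ℕ}

/-- The first entry of `x` that differs from `q / 2` is larger than `q / 2`. -/
def Leading (x : QVec q n) : Prop := ∃ i, q < 2 * (x i : ℕ) ∧ ∀ k < i, 2 * (x k : ℕ) = q

instance : DecidablePred (Leading : QVec q n → Prop) := fun x =>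
  inferInstanceAs (Decidable (∃ i, q < 2 * (x i : ℕ) ∧ ∀ k < i, 2 * (x k : ℕ) = q))

/-- The vectors of rank `r` whose first entry different from `q / 2` is larger than `q / 2`. -/
def leadingFamily (q n : ℕ) (r : ℤ) : Finset (QVec q n) :=
  univ.filter fun x => (rank x : ℤ) = r ∧ Leading x

theorem mem_leadingFamily {r : ℤ} {x : QVec q n} :
    x ∈ leadingFamily q n r ↔ (rank x : ℤ) = r ∧ Leading x := by
  simp [leadingFamily]

theorem rankUniform_leadingFamily (q n r : ℕ) : RankUniform r (leadingFamily q n r) :=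
  fun _ hx => Nat.cast_injective (mem_leadingFamily.1 hx).1

theorem Leading.meets {x y : QVec q n} (hx : Leading x) (hy : Leading y) : Meets x y := by
  obtain ⟨i, hi, hi'⟩ := hx
  obtain ⟨j, hj, hj'⟩ := hy
  rcases lt_trichotomy i j with h | rfl | h
  · have := hj' i h
    exact ⟨i, by omega⟩
  · exact ⟨i, by omega⟩
  · have := hi' j h
    exact ⟨j, by omega⟩

/-- The vector with the entries `q - x i`. -/
def reflect (x : QVec q n) : QVec q n := fun i => (x i).rev

theorem reflect_apply (x : QVec q n) (i : Fin n) : (reflect x i : ℕ) = q - x i := by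
  rw [reflect, Fin.val_rev]
  omega

theorem reflect_reflect (x : QVec q n) : reflect (reflect x) = x := by
  funext i
  simp [reflect]

theorem rank_add_rank_reflect (x : QVec q n) : rank x + rank (reflect x) = q * n := by
  rw [rank, rank, ← sum_add_distrib]
  have : ∀ i ∈ (univ : Finset (Fin n)), (x i : ℕ) + reflect x i = q := by
    intro i _
    have := (x i).is_lt
    rw [reflect_apply]
    omega
  rw [sum_congr rfl this]
  simp [mul_comm]

theorem not_meets_reflect (x : QVec q n) : ¬ Meets (reflect x) x := by
  rw [not_meets]
  intro i
  have := (x i).is_lt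
  rw [reflect_apply]
  omega

theorem leading_or_leading_reflect (x : QVec q n) (hx : ¬ ∀ i, 2 * (x i : ℕ) = q) :
    Leading x ∨ Leading (reflect x) := by
  push Not at hx
  obtain ⟨i, hi, hmin⟩ := wellFounded_lt.has_min {i | 2 * (x i : ℕ) ≠ q} hx
  have hmin' : ∀ k < i, 2 * (x k : ℕ) = q := by
    intro k hk
    by_contra h
    exact hmin k h hk
  have hi' : 2 * (x i : ℕ) ≠ q := hi
  rcases lt_or_gt_of_ne hi' with h | h
  · refine Or.inr ⟨i, ?_, fun k hk => ?_⟩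
    · rw [reflect_apply]
      omega
    · have := hmin' k hk
      rw [reflect_apply]
      omega
  · exact Or.inl ⟨i, h, hmin'⟩

theorem two_mul_rank_of_forall_eq {x : QVec q n} (hx : ∀ i, 2 * (x i : ℕ) = q) :
    2 * rank x = q * n := by
  rw [rank, mul_sum, sum_congr rfl fun i _ => hx i]
  simp [mul_comm]

/-- Append the entry `v` to `z`. -/
def append (z : QVec q n) (v : Fin (q + 1)) : QVec q (n + 1) :=
  Fin.snoc (α := fun _ => Fin (q + 1)) z v

@[simp] theorem append_castSucc (z : QVec q n) (v : Fin (q + 1)) (i : Fin n) :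
    append z v i.castSucc = z i := Fin.snoc_castSucc (α := fun _ => Fin (q + 1)) v z i

@[simp] theorem append_last (z : QVec q n) (v : Fin (q + 1)) :
    append z v (Fin.last n) = v := Fin.snoc_last (α := fun _ => Fin (q + 1)) v z

theorem rank_append (z : QVec q n) (v : Fin (q + 1)) : rank (append z v) = rank z + v := by
  simp [rank, Fin.sum_univ_castSucc]

theorem append_injective (v : Fin (q + 1)) :
    Function.Injective fun z : QVec q n => append z v := by
  intro z w h
  funext i
  have := congrFun h i.castSucc
  simpa using this

theorem meets_append {z w : QVec q n} {v v' : Fin (q + 1)} :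
    Meets (append z v) (append w v') ↔ Meets z w ∨ q < (v : ℕ) + v' := by
  rw [← not_iff_not, not_or, not_meets, not_meets, Fin.forall_fin_succ']
  simp

theorem Leading.append {z : QVec q n} (hz : Leading z) (v : Fin (q + 1)) :
    Leading (append z v) := by
  obtain ⟨i, hi, hlt⟩ := hz
  refine ⟨i.castSucc, by simpa using hi, fun k hk => ?_⟩
  have hk' : (k : ℕ) < i := hk
  have : k = Fin.castSucc ⟨k, hk'.trans i.is_lt⟩ := rfl
  rw [this, append_castSucc]
  exact hlt _ hk'

/-- The vectors that give a member of `F` when `v` is appended. -/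
def slice (F : Finset (QVec q (n + 1))) (v : Fin (q + 1)) : Finset (QVec q n) :=
  univ.filter fun z => append z v ∈ F

theorem mem_slice {F : Finset (QVec q (n + 1))} {v : Fin (q + 1)} {z : QVec q n} :
    z ∈ slice F v ↔ append z v ∈ F := by
  simp [slice]

theorem card_eq_sum_card_slice (F : Finset (QVec q (n + 1))) :
    F.card = ∑ v, (slice F v).card := by
  rw [card_eq_sum_card_fiberwise (f := fun x => x (Fin.last n)) (t := univ)
    (fun _ _ => mem_coe.2 (mem_univ _))]
  refine sum_congr rfl fun v _ => ?_
  rw [← card_image_of_injective (slice F v) (append_injective v)]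
  congr 1
  ext x
  rw [mem_filter, mem_image]
  constructor
  · rintro ⟨hx, rfl⟩
    have h : append (fun i : Fin n => x i.castSucc) (x (Fin.last n)) = x := by
      funext k
      refine Fin.lastCases ?_ (fun i => ?_) k <;> simp
    exact ⟨fun i => x i.castSucc, by rw [mem_slice, h]; exact hx, h⟩
  · rintro ⟨z, hz, rfl⟩
    exact ⟨mem_slice.1 hz, append_last z v⟩

/-- Units are moved one at a time from the last entry of `z` to coordinates where the sum with `w`
is below `q`, so no meeting is created. -/
theorem Stable.exists_append_mem {F : Finset (QVec q (n + 1))} (hF : Stable F) {r : ℕ}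
    (hr : RankUniform r F) (hrn : 2 * r ≤ q * (n + 1)) {z w : QVec q n} {v : Fin (q + 1)}
    (hz : z ∈ slice F v) (hw : w ∈ slice F v) (hzw : ¬ Meets z w) (t : ℕ)
    (ht : t + q ≤ 2 * v) :
    ∃ z' : QVec q n, ∃ v' : Fin (q + 1), (v' : ℕ) + t = v ∧ append z' v' ∈ F ∧
      ¬ Meets z' w := by
  induction t with
  | zero => exact ⟨z, v, rfl, mem_slice.1 hz, hzw⟩
  | succ t ih =>
    obtain ⟨z', v', hv', hmem, hnot⟩ := ih (by omega)
    rw [not_meets] at hnot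
    -- Otherwise the ranks give `q * n ≤ 2 * r - v - v'`, hence `v + v' ≤ q`, while `v + v' = 2 * v
    -- - t > q`.
    have hi : ∃ i, (z' i : ℕ) + w i < q := by
      by_contra hcon
      push Not at hcon
      have h1 := hr _ hmem
      have h2 := hr _ (mem_slice.1 hw)
      rw [rank_append] at h1 h2
      have h3 : ∑ i : Fin n, q ≤ ∑ i, ((z' i : ℕ) + w i) := sum_le_sum fun i _ => hcon i
      rw [sum_add_distrib] at h3
      simp only [sum_const, card_univ, Fintype.card_fin, smul_eq_mul] at h3
      change n * q ≤ rank z' + rank w at h3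
      have h4 := v.is_lt
      nlinarith
    obtain ⟨i, hi⟩ := hi
    have hv'lt := v'.is_lt
    have hvlt := v.is_lt
    refine ⟨Function.update z' i ⟨z' i + 1, by omega⟩, ⟨v' - 1, by omega⟩, by simp; omega, ?_, ?_⟩
    · refine hF.mem_of_lineKey_eq (Fin.castSucc_lt_last i) hmem ?_ (by simp)
      rw [lineKey_eq_iff]
      refine ⟨fun k => ?_, ?_⟩
      · refine Fin.lastCases (fun _ h => absurd rfl h) (fun k hk _ => ?_) k
        have : k ≠ i := fun h => hk (h ▸ rfl)
        simp [this]
      · simp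
        omega
    · rw [not_meets]
      intro k
      by_cases hk : k = i
      · subst hk
        simp
        omega
      · simpa [hk] using hnot k

theorem Stable.meetsPairwise_slice {F : Finset (QVec q (n + 1))} (hF : Stable F) {r : ℕ}
    (hr : RankUniform r F) (hrn : 2 * r ≤ q * (n + 1)) (hm : MeetsPairwise True F)
    (v : Fin (q + 1)) : MeetsPairwise True (slice F v) := by
  intro z hz w hw _
  by_contra hcon
  rcases le_total (2 * (v : ℕ)) q with hv | hv
  · have := hm _ (mem_slice.1 hz) _ (mem_slice.1 hw) fun _ => trivial
    rw [meets_append] at this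
    exact this.elim hcon (by omega)
  -- Moving `2 * v - q` units leaves the last entry `q - v`, which no longer meets `v`.
  · obtain ⟨z', v', hv', hmem, hnot⟩ :=
      hF.exists_append_mem hr hrn hz hw hcon (2 * v - q) (by omega)
    have := hm _ hmem _ (mem_slice.1 hw) fun _ => trivial
    rw [meets_append] at this
    exact this.elim hnot (by omega)

/-- Reflection carries rank `r - v` to rank `r - v'`. Since `v + v' ≤ q`, a vector of one slice and
its reflection in the other would give non-meeting members, whereas the leading family has a
representative of each reflected pair. -/
theorem card_slice_add_card_slice_le {r d : ℕ} (hd : 2 * r + d = q * (n + 1))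
    {F : Finset (QVec q (n + 1))} (hr : RankUniform r F) (hm : MeetsPairwise True F)
    {v v' : Fin (q + 1)} (hv : (v : ℕ) + v' + d = q) :
    (slice F v).card + (slice F v').card ≤
      (slice (leadingFamily q (n + 1) r) v).card +
        (slice (leadingFamily q (n + 1) r) v').card := by
  have hinj : Function.Injective (reflect : QVec q n → QVec q n) :=
    Function.LeftInverse.injective reflect_reflect
  have hd' : 2 * r + d = q * n + q := by rw [hd, mul_add, mul_one]
  have hrank : ∀ u : Fin (q + 1), ∀ z ∈ slice F u, rank z + u = r := by
    intro u z hz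
    rw [← rank_append]
    exact hr _ (mem_slice.1 hz)
  -- A constant `q / 2` vector forces `2 * u = q - d` by rank, so the appended vector would not meet
  -- itself.
  have hconst : ∀ u : Fin (q + 1), (u : ℕ) + d ≤ q → ∀ z ∈ slice F u,
      ¬ ∀ i, 2 * (z i : ℕ) = q := by
    intro u hu z hz hcon
    have h1 := hrank u z hz
    have h2 := two_mul_rank_of_forall_eq hcon
    have := hm _ (mem_slice.1 hz) _ (mem_slice.1 hz) fun _ => trivial
    rw [meets_append] at this
    rcases this with ⟨i, hi⟩ | h
    · have := hcon i
      omega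
    · omega
  have hdisj : Disjoint (slice F v) ((slice F v').image reflect) := by
    rw [disjoint_left]
    intro z hz hz'
    obtain ⟨w, hw, rfl⟩ := mem_image.1 hz'
    have := hm _ (mem_slice.1 hz) _ (mem_slice.1 hw) fun _ => trivial
    rw [meets_append] at this
    exact this.elim (not_meets_reflect w) (by omega)
  have hsub : ∀ u u' : Fin (q + 1), (u : ℕ) + u' + d = q → ∀ z ∈ slice F u,
      z ∈ slice (leadingFamily q (n + 1) r) u ∨
        reflect z ∈ slice (leadingFamily q (n + 1) r) u' := by
    intro u u' hu z hz
    have h1 := hrank u z hz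
    have h2 := rank_add_rank_reflect z
    rw [mem_slice, mem_slice, mem_leadingFamily, mem_leadingFamily, rank_append, rank_append]
    rcases leading_or_leading_reflect z (hconst u (by omega) z hz) with h | h
    · exact Or.inl ⟨by omega, h.append u⟩
    · exact Or.inr ⟨by omega, h.append u'⟩
  rw [← card_image_of_injective (slice F v') hinj, ← card_union_of_disjoint hdisj,
    ← card_image_of_injective (slice (leadingFamily q (n + 1) r) v') hinj]
  refine (card_le_card fun z hz => ?_).trans (card_union_le _ _)
  rw [mem_union] at hz ⊢
  rcases hz with hz | hz
  · exact (hsub v v' hv z hz).imp_right fun h => mem_image.2 ⟨_, h, reflect_reflect z⟩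
  · obtain ⟨w, hw, rfl⟩ := mem_image.1 hz
    exact (hsub v' v (by omega) w hw).symm.imp_right fun h => mem_image_of_mem _ h

theorem card_le_card_leadingFamily (r : ℕ) (F : Finset (QVec q n)) (hr : RankUniform r F)
    (hm : MeetsPairwise True F) (hrn : 2 * r ≤ q * n) :
    F.card ≤ (leadingFamily q n r).card := by
  induction n generalizing r with
  | zero =>
    have : F = ∅ := by
      rw [eq_empty_iff_forall_notMem]
      intro x hx
      obtain ⟨i, -⟩ := hm x hx x hx fun _ => trivial
      exact i.elim0
    simp [this]
  | succ n ih =>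
    obtain ⟨G, hstab, hGr, hGm, hcard⟩ := exists_stable (Or.inl trivial) F hr hm
    rw [← hcard, card_eq_sum_card_slice, card_eq_sum_card_slice]
    obtain ⟨d, hd⟩ := Nat.exists_eq_add_of_le hrn
    have hd' : 2 * r + d = q * n + q := by rw [← hd, mul_add, mul_one]
    -- For `v > q - d` one has `2 * (r - v) ≤ q * n`, as the induction requires; the remaining `v`
    -- are paired by `v ↦ q - d - v`.
    rw [← sum_filter_add_sum_filter_not univ (fun v : Fin (q + 1) => (v : ℕ) + d ≤ q),
      ← sum_filter_add_sum_filter_not univ (fun v : Fin (q + 1) => (v : ℕ) + d ≤ q)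
        (fun v => (slice (leadingFamily q (n + 1) r) v).card)]
    refine add_le_add ?_ (sum_le_sum fun v hv => ?_)
    · have hrefl : ∀ f : Fin (q + 1) → ℕ,
          ∑ v ∈ univ.filter (fun v : Fin (q + 1) => (v : ℕ) + d ≤ q), f v =
            ∑ v ∈ univ.filter (fun v : Fin (q + 1) => (v : ℕ) + d ≤ q), f ⟨q - d - v, by omega⟩ := by
        intro f
        refine sum_nbij' (fun v => ⟨q - d - v, by omega⟩) (fun v => ⟨q - d - v, by omega⟩)
          ?_ ?_ ?_ ?_ ?_
        · intro v hv
          simp only [mem_filter, mem_univ, true_and] at hv ⊢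
          omega
        · intro v hv
          simp only [mem_filter, mem_univ, true_and] at hv ⊢
          omega
        · intro v hv
          simp only [mem_filter, mem_univ, true_and] at hv
          ext
          simp only
          omega
        · intro v hv
          simp only [mem_filter, mem_univ, true_and] at hv
          ext
          simp only
          omega
        · intro v hv
          simp only [mem_filter, mem_univ, true_and] at hv
          congr 1
          ext
          simp only
          omega
      -- Summed over all `v`, the paired bounds count each slice twice, so a self-paired `v` needs
      -- no separate treatment.
      have hsum := sum_le_sum (s := univ.filter fun v : Fin (q + 1) => (v : ℕ) + d ≤ q)
        fun v hv => card_slice_add_card_slice_le (v := v) (v' := ⟨q - d - v, by omega⟩)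
          hd.symm hGr hGm (by
            simp only [mem_filter, mem_univ, true_and] at hv
            simp only
            omega)
      rw [sum_add_distrib, sum_add_distrib, ← hrefl (fun v => (slice G v).card),
        ← hrefl (fun v => (slice (leadingFamily q (n + 1) r) v).card)] at hsum
      omega
    · simp only [mem_filter, mem_univ, true_and] at hv
      by_cases hvr : (v : ℕ) ≤ r
      · refine (ih (r - v) (slice G v) (fun z hz => ?_)
          (hstab.meetsPairwise_slice hGr hrn hGm v) (by omega)).trans
          (card_le_card fun z hz => ?_)
        · have := hGr _ (mem_slice.1 hz)
          rw [rank_append] at this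
          omega
        · rw [mem_leadingFamily] at hz
          rw [mem_slice, mem_leadingFamily, rank_append]
          exact ⟨by omega, hz.2.append v⟩
      · have : slice G v = ∅ := by
          rw [eq_empty_iff_forall_notMem]
          intro z hz
          have := hGr _ (mem_slice.1 hz)
          rw [rank_append] at this
          omega
        simp [this]

/-- In a stable family, a member `x` not meeting itself can have one unit moved to its first entry.
As `q` is odd, `2 * x 0 + 1 ≤ q`, so the new member does not meet `x` either. -/
theorem exists_meetsPairwise_of_odd (hq : Odd q) {r : ℕ} (hqr : q < 2 * r)
    {F : Finset (QVec q n)} (hr : RankUniform r F) (hm : MeetsPairwise False F) :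
    ∃ G : Finset (QVec q n), RankUniform r G ∧ MeetsPairwise True G ∧ G.card = F.card := by
  obtain ⟨G, hstab, hGr, hGm, hcard⟩ := exists_stable (Or.inr hq) F hr hm
  refine ⟨G, hGr, fun x hx y hy _ => ?_, hcard⟩
  by_cases hxy : x = y
  swap
  · exact hGm x hx y hy hxy
  subst hxy
  by_contra hcon
  rw [not_meets] at hcon
  obtain ⟨p, hp⟩ := hq
  have hrank := hGr x hx
  have hn : 0 < n := by
    by_contra h0
    obtain rfl : n = 0 := by omega
    simp only [rank, univ_eq_empty, sum_empty] at hrank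
    omega
  obtain ⟨m, rfl⟩ : ∃ m, n = m + 1 := ⟨n - 1, by omega⟩
  -- Otherwise `r = x 0 ≤ q / 2`.
  have hj : ∃ j : Fin m, (x j.succ : ℕ) ≠ 0 := by
    by_contra h0
    push Not at h0
    rw [rank, Fin.sum_univ_succ] at hrank
    simp only [h0, sum_const_zero, add_zero] at hrank
    have := hcon 0
    omega
  obtain ⟨j, hj⟩ := hj
  have h0 := hcon 0
  have h0j := hcon j.succ
  have hne : j.succ ≠ 0 := Fin.succ_ne_zero j
  set y : QVec q (m + 1) := Function.update (Function.update x j.succ ⟨x j.succ - 1, by omega⟩) 0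
    ⟨x 0 + 1, by omega⟩ with hy
  have hy0 : (y 0 : ℕ) = x 0 + 1 := by simp [hy]
  have hyj : (y j.succ : ℕ) = x j.succ - 1 := by simp [hy, hne]
  have hyk : ∀ k, k ≠ 0 → k ≠ j.succ → y k = x k := fun k h1 h2 => by simp [hy, h1, h2]
  have hmem : y ∈ G := hstab.mem_of_lineKey_eq (Fin.succ_pos j) hx
    (lineKey_eq_iff.2 ⟨hyk, by omega⟩) (by omega)
  obtain ⟨k, hk⟩ := hGm y hmem x hx fun h => by
    rw [h] at hy0
    omega
  by_cases hk0 : k = 0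
  · subst hk0
    omega
  · by_cases hkj : k = j.succ
    · subst hkj
      omega
    · rw [hyk k hk0 hkj] at hk
      have := hcon k
      omega

end QVec

/-! ### Counting leading vectors, and the additional vector for even `q` -/

namespace QVec

variable {q n : ℕ}

theorem mem_layer {r : ℤ} {x : QVec q n} : x ∈ layer q n r ↔ (rank x : ℤ) = r := by
  simp [layer]

theorem layer_eq_empty_of_neg {r : ℤ} (hr : r < 0) : layer q n r = ∅ := by
  rw [eq_empty_iff_forall_notMem]
  intro x hx
  rw [mem_layer] at hx
  omega

/-- Prepend the entry `v` to `z`. -/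
def prepend (v : Fin (q + 1)) (z : QVec q n) : QVec q (n + 1) :=
  Fin.cons (α := fun _ => Fin (q + 1)) v z

@[simp] theorem prepend_zero (v : Fin (q + 1)) (z : QVec q n) : prepend v z 0 = v := rfl

@[simp] theorem prepend_succ (v : Fin (q + 1)) (z : QVec q n) (i : Fin n) :
    prepend v z i.succ = z i := rfl

theorem rank_prepend (v : Fin (q + 1)) (z : QVec q n) : rank (prepend v z) = v + rank z := by
  simp [rank, Fin.sum_univ_succ]

theorem leading_prepend {v : Fin (q + 1)} {z : QVec q n} :
    Leading (prepend v z) ↔ q < 2 * (v : ℕ) ∨ 2 * (v : ℕ) = q ∧ Leading z := by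
  rw [Leading, Fin.exists_fin_succ]
  refine or_congr (by simp) ?_
  simp only [Fin.forall_fin_succ, prepend_zero, prepend_succ, Fin.succ_pos, forall_const,
    Fin.succ_lt_succ_iff, Leading]
  constructor
  · rintro ⟨i, h1, h2, h3⟩
    exact ⟨h2, i, h1, h3⟩
  · rintro ⟨h2, i, h1, h3⟩
    exact ⟨i, h1, h2, h3⟩

theorem prepend_injective (v : Fin (q + 1)) :
    Function.Injective (prepend v : QVec q n → QVec q (n + 1)) := by
  intro z w h
  funext i
  exact congrFun h i.succ

theorem card_leadingFamily_succ (q n : ℕ) (r : ℤ) :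
    (leadingFamily q (n + 1) r).card = ∑ v ∈ range (q + 1),
      if q < 2 * v then (layer q n (r - v)).card
      else if 2 * v = q then (leadingFamily q n (r - v)).card else 0 := by
  rw [card_eq_sum_card_fiberwise (f := fun x => x 0) (t := univ)
    (fun _ _ => mem_coe.2 (mem_univ _)), ← Fin.sum_univ_eq_sum_range (fun v =>
      if q < 2 * v then (layer q n (r - v)).card
      else if 2 * v = q then (leadingFamily q n (r - v)).card else 0)]
  refine sum_congr rfl fun v _ => ?_
  have key : ∀ S : Finset (QVec q n),
      (∀ z, z ∈ S ↔ prepend v z ∈ leadingFamily q (n + 1) r) →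
      ((leadingFamily q (n + 1) r).filter fun x => x 0 = v).card = S.card := by
    intro S hS
    rw [← card_image_of_injective S (prepend_injective v)]
    congr 1
    ext x
    rw [mem_filter, mem_image]
    constructor
    · rintro ⟨hx, rfl⟩
      have h : prepend (x 0) (fun i : Fin n => x i.succ) = x := by
        funext k
        refine Fin.cases ?_ (fun i => ?_) k <;> rfl
      exact ⟨_, (hS _).2 (h.symm ▸ hx), h⟩
    · rintro ⟨z, hz, rfl⟩
      exact ⟨(hS z).1 hz, rfl⟩
  split_ifs with h1 h2
  · refine key _ fun z => ?_
    rw [mem_layer, mem_leadingFamily, leading_prepend, rank_prepend]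
    constructor
    · exact fun h => ⟨by omega, Or.inl h1⟩
    · rintro ⟨h, -⟩
      omega
  · refine key _ fun z => ?_
    rw [mem_leadingFamily, mem_leadingFamily, leading_prepend, rank_prepend]
    constructor
    · exact fun h => ⟨by omega, Or.inr ⟨h2, h.2⟩⟩
    · rintro ⟨h, h' | h'⟩
      · exact absurd h' h1
      · exact ⟨by omega, h'.2⟩
  · refine (key ∅ fun z => ?_).trans card_empty
    rw [mem_leadingFamily, leading_prepend]
    simp [h1, h2]

theorem card_leadingFamily_of_odd (hq : Odd q) (hn : 1 ≤ n) (r : ℤ) :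
    (leadingFamily q n r).card = ∑ j ∈ Icc ((q + 1) / 2) q, (layer q (n - 1) (r - j)).card := by
  obtain ⟨m, rfl⟩ : ∃ m, n = m + 1 := ⟨n - 1, by omega⟩
  obtain ⟨p, hp⟩ := hq
  rw [card_leadingFamily_succ, Nat.add_sub_cancel]
  symm
  apply sum_subset_zero_on_sdiff
  · intro v hv
    rw [mem_Icc] at hv
    rw [mem_range]
    omega
  · intro v hv
    rw [mem_sdiff, mem_range, mem_Icc] at hv
    rw [if_neg (by omega), if_neg (by omega)]
  · intro v hv
    rw [mem_Icc] at hv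
    rw [if_pos (by omega)]

theorem card_leadingFamily_succ_two_mul (h n : ℕ) (r : ℤ) :
    (leadingFamily (2 * h) (n + 1) r).card =
      ∑ j ∈ Icc (h + 1) (2 * h), (layer (2 * h) n (r - j)).card +
        (leadingFamily (2 * h) n (r - h)).card := by
  rw [card_leadingFamily_succ, ← sum_erase_add _ _ (mem_range.2 (by omega : h < 2 * h + 1)),
    if_neg (by omega), if_pos rfl]
  congr 1
  symm
  apply sum_subset_zero_on_sdiff
  · intro v hv
    rw [mem_Icc] at hv
    rw [mem_erase, mem_range]
    omega
  · intro v hv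
    rw [mem_sdiff, mem_erase, mem_range, mem_Icc] at hv
    rw [if_neg (by omega), if_neg (by omega)]
  · intro v hv
    rw [mem_Icc] at hv
    rw [if_pos (by omega)]

theorem card_leadingFamily_two_mul (h n : ℕ) (r : ℤ) :
    (leadingFamily (2 * h) n r).card = ∑ i ∈ range n, ∑ j ∈ Icc (h + 1) (2 * h),
      (layer (2 * h) (n - (i + 1)) (r - j - i * h)).card := by
  induction n generalizing r with
  | zero =>
    rw [range_zero, sum_empty, card_eq_zero, eq_empty_iff_forall_notMem]
    intro x hx
    obtain ⟨i, -⟩ := (mem_leadingFamily.1 hx).2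
    exact i.elim0
  | succ n ih =>
    rw [card_leadingFamily_succ_two_mul, ih, sum_range_succ', add_comm]
    congr 1
    · refine sum_congr rfl fun i _ => sum_congr rfl fun j _ => ?_
      rw [Nat.add_sub_add_right]
      congr 2
      push_cast
      ring
    · refine sum_congr rfl fun j _ => ?_
      rw [Nat.add_sub_add_right]
      congr 2
      simp

theorem card_leadingFamily_of_even {q n r : ℕ} (hq : Even q) (hq1 : 1 ≤ q)
    (hrn : 2 * r ≤ q * n) :
    (leadingFamily q n r).card = ∑ j ∈ Icc ⌈((q : ℚ) + 1) / 2⌉₊ q,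
      ∑ i ∈ Icc 1 ⌊2 * ((r : ℚ) - 1) / q⌋₊,
        (layer q (n - i) ((r : ℤ) - j - ((i : ℤ) - 1) * q / 2)).card := by
  obtain ⟨h, rfl⟩ := hq.exists_two_nsmul
  rw [smul_eq_mul] at *
  have hceil : ⌈(((2 * h : ℕ) : ℚ) + 1) / 2⌉₊ = h + 1 := by
    rw [Nat.ceil_eq_iff (by omega)]
    push_cast
    constructor <;> linarith
  -- With `h = q / 2`, the upper limit of `i` means `i * h < r`. Beyond it the rank `r - j - (i - 1)
  -- * h` is negative because `j ≥ h + 1`, so the omitted layers are empty.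
  have hfloor : ∀ i : ℕ, 1 ≤ i →
      (i ≤ ⌊2 * ((r : ℚ) - 1) / ((2 * h : ℕ) : ℚ)⌋₊ ↔ i * h + 1 ≤ r) := by
    intro i hi
    have hpos : (0 : ℚ) < ((2 * h : ℕ) : ℚ) := by exact_mod_cast hq1
    rw [Nat.le_floor_iff' (by omega), le_div_iff₀ hpos, ← Nat.cast_le (α := ℚ)]
    push_cast
    constructor <;> intro _ <;> linarith
  have hT : ∀ i ∈ range n, ∑ j ∈ Icc (h + 1) (2 * h),
      (layer (2 * h) (n - (i + 1)) ((r : ℤ) - j - i * h)).card =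
      ∑ j ∈ Icc (h + 1) (2 * h), (layer (2 * h) (n - (i + 1))
        ((r : ℤ) - j - (((i + 1 : ℕ) : ℤ) - 1) * (2 * h : ℕ) / 2)).card := by
    intro i _
    refine sum_congr rfl fun j _ => ?_
    have : (((i + 1 : ℕ) : ℤ) - 1) * (2 * h : ℕ) / 2 = i * h := by
      push_cast
      rw [show ((i : ℤ) + 1 - 1) * (2 * h) = 2 * (i * h) by ring]
      omega
    rw [this]
  rw [hceil, sum_comm, card_leadingFamily_two_mul, sum_congr rfl hT, range_eq_Ico,
    sum_Ico_add' (fun i => ∑ j ∈ Icc (h + 1) (2 * h), (layer (2 * h) (n - i)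
      ((r : ℤ) - j - ((i : ℤ) - 1) * (2 * h : ℕ) / 2)).card) 0 n 1]
  symm
  apply sum_subset
  · intro i hi
    rw [mem_Icc] at hi
    have h1 := (hfloor i hi.1).1 hi.2
    rw [mem_Ico]
    have : i < n := by
      by_contra hcon
      push Not at hcon
      have := Nat.mul_le_mul_right h hcon
      nlinarith
    omega
  · intro i hi hi'
    rw [mem_Ico] at hi
    rw [mem_Icc, not_and, hfloor i (by omega)] at hi'
    have hir := hi' (by omega)
    refine sum_eq_zero fun j hj => ?_
    rw [mem_Icc] at hj
    obtain ⟨k, rfl⟩ : ∃ k, i = k + 1 := ⟨i - 1, by omega⟩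
    rw [card_eq_zero]
    apply layer_eq_empty_of_neg
    rw [show (((k + 1 : ℕ) : ℤ) - 1) * (2 * h : ℕ) = 2 * ((k * h : ℕ) : ℤ) by push_cast; ring]
    rw [add_mul, one_mul] at hir
    omega

/-- The vector `(h, …, h, c, 0, …, 0)` of rank `min r (h n)` with entries at most `h`. -/
def balanced (q h n r : ℕ) (hq : h ≤ q) : QVec q n :=
  fun i => ⟨min h (r - i * h), by omega⟩

theorem rank_balanced {q h n r : ℕ} (hq : h ≤ q) (hr : r ≤ n * h) :
    rank (balanced q h n r hq) = r := by
  have key : ∀ m : ℕ, ∑ i ∈ range m, min h (r - i * h) = min r (m * h) := by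
    intro m
    induction m with
    | zero => simp
    | succ m ih =>
      rw [sum_range_succ, ih, add_mul, one_mul]
      omega
  have := Fin.sum_univ_eq_sum_range (fun i => min h (r - i * h)) n
  rw [key, min_eq_left hr] at this
  exact this

theorem not_leading_balanced {h n r : ℕ} (hq : h ≤ 2 * h) :
    ¬ Leading (balanced (2 * h) h n r hq) := by
  rintro ⟨i, hi, -⟩
  simp only [balanced] at hi
  omega

/-- The entries of `x` before the decisive position `i` are `h` and `x i > h`, so the rank exceeds
`(i + 1) * h` and the balanced vector still has entry `h` at `i`. -/
theorem Leading.meets_balanced {h n : ℕ} (hq : h ≤ 2 * h) {x : QVec (2 * h) n}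
    (hx : Leading x) : Meets x (balanced (2 * h) h n (rank x) hq) := by
  obtain ⟨i, hi, hlt⟩ := hx
  refine ⟨i, ?_⟩
  have hrank : (i : ℕ) * h + x i ≤ rank x := by
    have hsub : insert i (Iio i) ⊆ (univ : Finset (Fin n)) := subset_univ _
    have h1 : ∑ k ∈ insert i (Iio i), (x k : ℕ) ≤ rank x :=
      sum_le_sum_of_subset hsub
    rw [sum_insert (by simp), sum_congr rfl (g := fun _ => h) (fun k hk => by
      have := hlt k (mem_Iio.1 hk)
      omega)] at h1
    rw [sum_const, Fin.card_Iio, smul_eq_mul] at h1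
    omega
  simp only [balanced]
  omega

end QVec

/-! ### Even `q` and the final theorem -/

namespace QVec

variable {q n : ℕ}

theorem sumIntersecting_iff (F : Finset (QVec q n)) :
    SumIntersecting (q + 1) F ↔ MeetsPairwise False F :=
  forall₅_congr fun _ _ _ _ _ => one_le_sumInter

theorem meetsPairwise_leadingFamily (W : Prop) (r : ℤ) :
    MeetsPairwise W (leadingFamily q n r) :=
  fun _ hx _ hy _ => (mem_leadingFamily.1 hx).2.meets (mem_leadingFamily.1 hy).2

theorem card_le_card_leadingFamily_add_one {r : ℕ} {F : Finset (QVec q n)}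
    (hr : RankUniform r F) (hm : MeetsPairwise False F) (hrn : 2 * r ≤ q * n) :
    F.card ≤ (leadingFamily q n r).card + 1 := by
  classical
  -- A vector not meeting itself has all entries at most `q / 2`, so two such vectors never meet.
  have hsub : ∀ x ∈ F, ∀ y ∈ F, ¬ Meets x x → ¬ Meets y y → x = y := by
    intro x hx y hy hxx hyy
    by_contra hne
    rw [not_meets] at hxx hyy
    obtain ⟨i, hi⟩ := hm x hx y hy hne
    have := hxx i
    have := hyy i
    omega
  have hstrong : MeetsPairwise True (F.filter fun x => Meets x x) := by
    intro x hx y hy _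
    rw [mem_filter] at hx hy
    by_cases hxy : x = y
    · exact hxy ▸ hx.2
    · exact hm x hx.1 y hy.1 hxy
  rw [← card_filter_add_card_filter_not (fun x => Meets x x)]
  refine add_le_add (card_le_card_leadingFamily r _
    (fun x hx => hr x (mem_filter.1 hx).1) hstrong hrn) (card_le_one.2 fun x hx y hy => ?_)
  rw [mem_filter] at hx hy
  exact hsub x hx.1 y hy.1 hx.2 hy.2

theorem exists_card_eq_card_leadingFamily_add_one {r : ℕ} (hq : Even q)
    (hrn : 2 * r ≤ q * n) :
    ∃ F : Finset (QVec q n), RankUniform r F ∧ MeetsPairwise False F ∧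
      F.card = (leadingFamily q n r).card + 1 := by
  obtain ⟨h, rfl⟩ := hq.exists_two_nsmul
  rw [smul_eq_mul] at *
  have hh : h ≤ 2 * h := by omega
  have hrank : rank (balanced (2 * h) h n r hh) = r := by
    apply rank_balanced
    nlinarith
  have hmeets : ∀ x ∈ leadingFamily (2 * h) n r, Meets x (balanced (2 * h) h n r hh) := by
    intro x hx
    have h1 := rankUniform_leadingFamily (2 * h) n r x hx
    subst h1
    exact (mem_leadingFamily.1 hx).2.meets_balanced hh
  refine ⟨insert (balanced (2 * h) h n r hh) (leadingFamily (2 * h) n r), ?_, ?_,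
    card_insert_of_notMem fun hmem => not_leading_balanced hh (mem_leadingFamily.1 hmem).2⟩
  · intro x hx
    rcases mem_insert.1 hx with rfl | hx
    · exact hrank
    · exact rankUniform_leadingFamily (2 * h) n r x hx
  · intro x hx y hy hxy
    rcases mem_insert.1 hx with rfl | hx <;> rcases mem_insert.1 hy with rfl | hy
    · exact absurd rfl hxy
    · exact (hmeets y hy).symm
    · exact hmeets x hx
    · exact meetsPairwise_leadingFamily False r x hx y hy hxy

end QVec

theorem theorem3 (n q r : ℕ) (hn : 1 ≤ n) (hq : 1 ≤ q) (hr : 1 ≤ r)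
    (hlow : ((q : ℚ) + 1) / 2 ≤ r) (hupp : (r : ℚ) ≤ (q : ℚ) * n / 2) :
    (Even (q + 1) →
      (∀ F : Finset (QVec q n), QVec.RankUniform r F → QVec.SumIntersecting (q + 1) F →
        F.card ≤ ∑ j ∈ Finset.Icc ((q + 1) / 2) q, (QVec.layer q (n - 1) ((r : ℤ) - j)).card) ∧
      (∃ F : Finset (QVec q n), QVec.RankUniform r F ∧ QVec.SumIntersecting (q + 1) F ∧
        F.card = ∑ j ∈ Finset.Icc ((q + 1) / 2) q, (QVec.layer q (n - 1) ((r : ℤ) - j)).card)) ∧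
    (Odd (q + 1) →
      (∀ F : Finset (QVec q n), QVec.RankUniform r F → QVec.SumIntersecting (q + 1) F →
        F.card ≤ 1 + ∑ j ∈ Finset.Icc ⌈((q : ℚ) + 1) / 2⌉₊ q,
          ∑ i ∈ Finset.Icc 1 ⌊2 * ((r : ℚ) - 1) / q⌋₊,
            (QVec.layer q (n - i) ((r : ℤ) - j - ((i : ℤ) - 1) * q / 2)).card) ∧
      (∃ F : Finset (QVec q n), QVec.RankUniform r F ∧ QVec.SumIntersecting (q + 1) F ∧
        F.card = 1 + ∑ j ∈ Finset.Icc ⌈((q : ℚ) + 1) / 2⌉₊ q,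
          ∑ i ∈ Finset.Icc 1 ⌊2 * ((r : ℚ) - 1) / q⌋₊,
            (QVec.layer q (n - i) ((r : ℤ) - j - ((i : ℤ) - 1) * q / 2)).card)) := by
  have hrn : 2 * r ≤ q * n := by
    have : (2 * r : ℚ) ≤ q * n := by linarith
    exact_mod_cast this
  have hqr : q < 2 * r := by
    have : (q + 1 : ℚ) ≤ 2 * r := by linarith
    exact_mod_cast this
  constructor
  · intro heven
    have hodd : Odd q := by
      rcases Nat.even_or_odd q with h | h
      · exact absurd heven (Nat.not_even_iff_odd.2 h.add_one)
      · exact h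
    rw [← QVec.card_leadingFamily_of_odd hodd hn]
    refine ⟨fun F hr hF => ?_, _, QVec.rankUniform_leadingFamily q n r, ?_, rfl⟩
    · obtain ⟨G, hGr, hGm, hcard⟩ := QVec.exists_meetsPairwise_of_odd hodd hqr hr
        ((QVec.sumIntersecting_iff F).1 hF)
      rw [← hcard]
      exact QVec.card_le_card_leadingFamily r G hGr hGm hrn
    · exact (QVec.sumIntersecting_iff _).2 (QVec.meetsPairwise_leadingFamily False r)
  · intro hodd
    have heven : Even q := by
      rcases Nat.even_or_odd q with h | h
      · exact h
      · exact absurd hodd (Nat.not_odd_iff_even.2 h.add_one)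
    rw [← QVec.card_leadingFamily_of_even heven hq hrn, add_comm 1]
    refine ⟨fun F hr hF => ?_, ?_⟩
    · exact QVec.card_le_card_leadingFamily_add_one hr ((QVec.sumIntersecting_iff F).1 hF) hrn
    · obtain ⟨F, hr, hF, hcard⟩ := QVec.exists_card_eq_card_leadingFamily_add_one heven hrn
      exact ⟨F, hr, (QVec.sumIntersecting_iff F).2 hF, hcard⟩
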